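/- All composites are written in the usual order, $\gamma: U(gf)\Rightarrow Ug\circ Uf$ and $\iota: U1\Rightarrow 1$ denote the (invertible) compositor and unitor of a pseudofunctor $U$, and a colax functor $F$ has (not necessarily invertible) 2-cells $F(gf)\Rightarrow Fg\circ Ff$, $F1_A\Rightarrow 1_{FA}$. A colax natural transformation $\alpha:F\Rightarrow G$ has 1-cells $\alpha_A:FA\to GA$ and 2-cells $\alpha_f:\alpha_B\circ Ff\Rightarrow Gf\circ\alpha_A$. **Definitions.** Let $U:\mathcal C\to\mathcal D$ be a pseudofunctor between 2-categories (or, more generally, bicategories). Suppose given for each object $A\in\mathcal D$ an object $FA\in\mathcal C$ and a 1-cell $y_A:A\to UFA$. A *left $U$-extension* of $f:A\to UB$ along $y_A$ is a pair $(f':FA\to B,\ \psi:f\Rightarrow Uf'\circ y_A)$ such that for every pair $(g:FA\to B,\ \alpha:f\Rightarrow Ug\circ y_A)$ there is a unique 2-cell $\theta:f'\Rightarrow g$ with $(U\theta\, y_A)\cdot\psi=\alpha$. The collection $(y_A)$ is *coherently closed for $U$-extensions* if there is a choice of a left $U$-extension $(f^{\mathbb D},\mathbb D_f)$ along $y_A$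 of every $f:A\to UB$, such that for every $f:X\to UY$ the 1-cell $1_{UY}^{\mathbb D}\circ(y_{UY}f)^{\mathbb D}$ with the 2-cell $$f\xrightarrow{\mathbb D_{1_{UY}}f}U1_{UY}^{\mathbb D}\, y_{UY}f\xrightarrow{U1_{UY}^{\mathbb D}\,\mathbb D_{y_{UY}f}}U1_{UY}^{\mathbb D}\, U(y_{UY}f)^{\mathbb D}\,y_X\xrightarrow{\gamma^{-1}y_X}U\big(1_{UY}^{\mathbb D}(y_{UY}f)^{\mathbb D}\big)y_X$$ is a left $U$-extension of $f$ along $y_X$. A *colax adjunction* $(\Psi,\Phi):(\epsilon,\eta):F\dashv\!\!\!\!\!\!\dashv U$ between pseudofunctors $F:\mathcal D\to\mathcal C$, $U:\mathcal C\to\mathcal D$ consists of colax natural transformations $\eta:1\Rightarrow UF$, $\epsilon:FU\Rightarrow1$ and modifications $\Psi:\epsilon F\circ F\eta\to1_F$, $\Phi:1_U\to U\epsilon\circ\eta U$ such that for all $A\in\mathcal D$, $B\in\mathcal C$ the two composites $$\eta_A\xrightarrow{\Phi_{FA}\eta_A}U\epsilon_{FA}\,\eta_{UFA}\,\eta_A\xrightarrow{U\epsilon_{FA}\,\eta_{\eta_A}}U\epsilon_{FA}\,UF\eta_A\,\eta_A\xrightarrow{(U\Psi)_A\eta_A}\eta_A,$$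 $$\epsilon_B\xrightarrow{\epsilon_B(F\Phi)_B}\epsilon_B\,FU\epsilon_B\,F\eta_{UB}\xrightarrow{\epsilon_{\epsilon_B}F\eta_{UB}}\epsilon_B\,\epsilon_{FUB}\,F\eta_{UB}\xrightarrow{\epsilon_B\Psi_{UB}}\epsilon_B$$ are identities, where $U\Psi$ and $F\Phi$ are understood to include the evident compositors and unitors of $U$ and $F$. **Theorem (generalized Bunge–Gray theorem).** Let $U:\mathcal C\to\mathcal D$ be a pseudofunctor and $y_A:A\to UFA$ ($A\in\mathcal D$) a collection of 1-cells coherently closed for $U$-extensions. Then: 1. the mapping $A\mapsto FA$ can be extended to a colax functor $F:\mathcal D\to\mathcal C$; 2. $y$ can be extended to a colax natural transformation $y:1_{\mathcal D}\Rightarrow UF$; 3. there exist a colax natural transformation $\epsilon:FU\Rightarrow1_{\mathcal C}$ and a modification $\Phi:1_U\to U\epsilon\circ yU$. Assume moreover the *unit axiom*: for every $A\in\mathcal D$, $1_{FA}$ with $\iota^{-1}y_A:y_A\Rightarrow U1_{FA}\circ y_A$ is a left $U$-extension of $y_A$ along $y_A$; and the *composition axiom*: for all $f:A\to B$, $g:B\to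 C$ in $\mathcal D$, the 1-cell $(y_Cg)^{\mathbb D}(y_Bf)^{\mathbb D}$ with the 2-cell $$y_Cgf\xrightarrow{\mathbb D_{y_Cg}f}U(y_Cg)^{\mathbb D}\,y_Bf\xrightarrow{U(y_Cg)^{\mathbb D}\,\mathbb D_{y_Bf}}U(y_Cg)^{\mathbb D}\,U(y_Bf)^{\mathbb D}\,y_A\xrightarrow{\gamma^{-1}y_A}U\big((y_Cg)^{\mathbb D}(y_Bf)^{\mathbb D}\big)y_A$$ is a left $U$-extension of $y_Cgf$ along $y_A$. Then: 4. $F$ is a pseudofunctor; 5. there is an invertible modification $\Psi:\epsilon F\circ Fy\to1_F$, and all this data give a colax adjunction $(\Psi,\Phi):(\epsilon,y):F\dashv\!\!\!\!\!\!\dashv U$. -/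

import Mathlib

open CategoryTheory CategoryTheory.Bicategory
open scoped CategoryTheory.Oplax.OplaxTrans

universe w₁ w₂ w₃ v₁ v₂ v₃ u₁ u₂ u₃

/-! Composition is written in diagrammatic order: `f ≫ g` is `g ∘ f`. Colax functors, colax natural
transformations and modifications between the latter are `OplaxFunctor` (`⥤ᵒᵖᴸ`),
`Oplax.OplaxTrans` and `Oplax.OplaxTrans.Modification`. -/

namespace ColaxAdj

section Extensions

variable {C : Type u₁} [Bicategory.{w₁, v₁} C] {D : Type u₂} [Bicategory.{w₂, v₂} D]

/-- The pair `(f', ψ)` is a left `U`-extension of `f : A ⟶ U B` along `y : A ⟶ U X`. -/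
def IsLeftUExtension (U : C ⥤ᵖ D) {A : D} {X B : C} (y : A ⟶ U.obj X) (f : A ⟶ U.obj B)
    (f' : X ⟶ B) (ψ : f ⟶ y ≫ U.map f') : Prop :=
  ∀ (g : X ⟶ B) (α : f ⟶ y ≫ U.map g), ∃! θ : f' ⟶ g, ψ ≫ y ◁ U.map₂ θ = α

/-- The pasting of a square `φ : f ≫ z ⟶ y ≫ U f'` with `ψ : g ⟶ z ≫ U g'` below it, followed by
the inverse of the compositor `U (f' ≫ g') ≅ U f' ≫ U g'`. -/
def pasteCell (U : C ⥤ᵖ D) {A B : D} {X Y Z : C} {y : A ⟶ U.obj X} {z : B ⟶ U.obj Y}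
    {f : A ⟶ B} {g : B ⟶ U.obj Z} {f' : X ⟶ Y} {g' : Y ⟶ Z}
    (φ : f ≫ z ⟶ y ≫ U.map f') (ψ : g ⟶ z ≫ U.map g') :
    f ≫ g ⟶ y ≫ U.map (f' ≫ g') :=
  f ◁ ψ ≫ (α_ f z (U.map g')).inv ≫ φ ▷ U.map g' ≫ (α_ y (U.map f') (U.map g')).hom ≫
    y ◁ (U.mapComp f' g').inv

/-- The collection `y A : A ⟶ U (F₀ A)` is coherently closed for `U`-extensions: a choice of a left
`U`-extension `(ext f, cell f)` of every `f : A ⟶ U B` along `y A`, such that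
`ext (f ≫ y (U Y)) ≫ ext (𝟙 (U Y))` with the pasted 2-cell is a left `U`-extension of
every `f : X ⟶ U Y`. -/
structure CoherentlyClosed (U : C ⥤ᵖ D) (F₀ : D → C) (y : ∀ A : D, A ⟶ U.obj (F₀ A)) where
  ext {A : D} {B : C} (f : A ⟶ U.obj B) : F₀ A ⟶ B
  cell {A : D} {B : C} (f : A ⟶ U.obj B) : f ⟶ y A ≫ U.map (ext f)
  isLeftUExtension {A : D} {B : C} (f : A ⟶ U.obj B) :
    IsLeftUExtension U (y A) f (ext f) (cell f)
  coherent {X : D} {Y : C} (f : X ⟶ U.obj Y) :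
    IsLeftUExtension U (y X) f (ext (f ≫ y (U.obj Y)) ≫ ext (𝟙 (U.obj Y)))
      ((ρ_ f).inv ≫ pasteCell U (cell (f ≫ y (U.obj Y))) (cell (𝟙 (U.obj Y))))

/-- The unit axiom for `U`-extensions. -/
def UnitAxiom (U : C ⥤ᵖ D) (F₀ : D → C) (y : ∀ A : D, A ⟶ U.obj (F₀ A)) : Prop :=
  ∀ A : D, IsLeftUExtension U (y A) (y A) (𝟙 (F₀ A))
    ((ρ_ (y A)).inv ≫ y A ◁ (U.mapId (F₀ A)).inv)

/-- The composition axiom for the chosen `U`-extensions. -/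
def CompositionAxiom {U : C ⥤ᵖ D} {F₀ : D → C} {y : ∀ A : D, A ⟶ U.obj (F₀ A)}
    (E : CoherentlyClosed U F₀ y) : Prop :=
  ∀ {A B Z : D} (f : A ⟶ B) (g : B ⟶ Z),
    IsLeftUExtension U (y A) (f ≫ g ≫ y Z) (E.ext (f ≫ y B) ≫ E.ext (g ≫ y Z))
      (pasteCell U (E.cell (f ≫ y B)) (E.cell (g ≫ y Z)))

end Extensions

section Whiskering

variable {B : Type u₁} [Bicategory.{w₁, v₁} B] {C : Type u₂} [Bicategory.{w₂, v₂} C]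
  {D : Type u₃} [Bicategory.{w₃, v₃} D]

/-- The colax transformation `αH : FH ⇒ GH` with components `α_{H a}`. -/
def pre (H : B ⥤ᵒᵖᴸ C) {F G : C ⥤ᵒᵖᴸ D} (α : Oplax.OplaxTrans F G) :
    Oplax.OplaxTrans (H.comp F) (H.comp G) where
  app a := α.app (H.obj a)
  naturality f := α.naturality (H.map f)
  naturality_naturality η := α.naturality_naturality (H.map₂ η)
  naturality_id a := by
    have h : α.naturality (H.map (𝟙 a)) ≫
        α.app (H.obj a) ◁ (G.map₂ (H.mapId a) ≫ G.mapId (H.obj a)) =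
        (F.map₂ (H.mapId a) ≫ F.mapId (H.obj a)) ▷ α.app (H.obj a) ≫
          (λ_ (α.app (H.obj a))).hom ≫ (ρ_ (α.app (H.obj a))).inv := by
      rw [whiskerLeft_comp, ← α.naturality_naturality_assoc, α.naturality_id, comp_whiskerRight,
        Category.assoc]
    exact h
  naturality_comp {a b c} f g := by
    have h : α.naturality (H.map (f ≫ g)) ≫
        α.app (H.obj a) ◁ (G.map₂ (H.mapComp f g) ≫ G.mapComp (H.map f) (H.map g)) =
        (F.map₂ (H.mapComp f g) ≫ F.mapComp (H.map f) (H.map g)) ▷ α.app (H.obj c) ≫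
          (α_ _ _ _).hom ≫ F.map (H.map f) ◁ α.naturality (H.map g) ≫
          (α_ _ _ _).inv ≫ α.naturality (H.map f) ▷ G.map (H.map g) ≫ (α_ _ _ _).hom := by
      rw [whiskerLeft_comp, ← α.naturality_naturality_assoc, α.naturality_comp,
        comp_whiskerRight, Category.assoc]
    exact h

/-- The colax transformation `Pα : PF ⇒ PG` with components `P α_a`, for a pseudofunctor `P`. -/
def post {F G : B ⥤ᵒᵖᴸ C} (α : Oplax.OplaxTrans F G) (P : C ⥤ᵖ D) :
    Oplax.OplaxTrans (F.comp P.toOplax) (G.comp P.toOplax) where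
  app a := P.map (α.app a)
  naturality {a b} f := (P.mapComp (F.map f) (α.app b)).inv ≫ P.map₂ (α.naturality f) ≫
    (P.mapComp (α.app a) (G.map f)).hom
  naturality_naturality {a b f g} η := by
    change P.map₂ (F.map₂ η) ▷ P.map (α.app b) ≫ (P.mapComp (F.map g) (α.app b)).inv ≫
        P.map₂ (α.naturality g) ≫ (P.mapComp (α.app a) (G.map g)).hom =
      ((P.mapComp (F.map f) (α.app b)).inv ≫ P.map₂ (α.naturality f) ≫
        (P.mapComp (α.app a) (G.map f)).hom) ≫ P.map (α.app a) ◁ P.map₂ (G.map₂ η)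
    have h := congrArg P.map₂ (α.naturality_naturality η)
    simp only [P.map₂_comp, P.map₂_whisker_left, P.map₂_whisker_right, Category.assoc] at h
    rw [← cancel_epi (P.mapComp (F.map f) (α.app b)).hom,
      ← cancel_mono (P.mapComp (α.app a) (G.map g)).inv]
    simpa using h
  naturality_id a := by
    change ((P.mapComp (F.map (𝟙 a)) (α.app a)).inv ≫ P.map₂ (α.naturality (𝟙 a)) ≫
      (P.mapComp (α.app a) (G.map (𝟙 a))).hom) ≫
      P.map (α.app a) ◁ (P.map₂ (G.mapId a) ≫ (P.mapId (G.obj a)).hom) =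
      (P.map₂ (F.mapId a) ≫ (P.mapId (F.obj a)).hom) ▷ P.map (α.app a) ≫
        (λ_ (P.map (α.app a))).hom ≫ (ρ_ (P.map (α.app a))).inv
    have h := congrArg P.map₂ (α.naturality_id a)
    have hr : P.map₂ (ρ_ (α.app a)).inv = (ρ_ (P.map (α.app a))).inv ≫
        P.map (α.app a) ◁ (P.mapId (G.obj a)).inv ≫ (P.mapComp (α.app a) (𝟙 _)).inv := by
      rw [P.mapComp_id_right_inv]
      simp
    simp only [P.map₂_comp, P.map₂_whisker_left, P.map₂_whisker_right, Category.assoc,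
      P.map₂_left_unitor, hr] at h
    rw [← cancel_epi (P.mapComp (F.map (𝟙 a)) (α.app a)).hom,
      ← cancel_mono (P.map (α.app a) ◁ (P.mapId (G.obj a)).inv),
      ← cancel_mono (P.mapComp (α.app a) (𝟙 (G.obj a))).inv]
    simpa using h
  naturality_comp {a b c} f g := by
    change ((P.mapComp (F.map (f ≫ g)) (α.app c)).inv ≫ P.map₂ (α.naturality (f ≫ g)) ≫
      (P.mapComp (α.app a) (G.map (f ≫ g))).hom) ≫
      P.map (α.app a) ◁ (P.map₂ (G.mapComp f g) ≫ (P.mapComp (G.map f) (G.map g)).hom) =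
      (P.map₂ (F.mapComp f g) ≫ (P.mapComp (F.map f) (F.map g)).hom) ▷ P.map (α.app c) ≫
        (α_ (P.map (F.map f)) (P.map (F.map g)) (P.map (α.app c))).hom ≫
        P.map (F.map f) ◁ ((P.mapComp (F.map g) (α.app c)).inv ≫ P.map₂ (α.naturality g) ≫
          (P.mapComp (α.app b) (G.map g)).hom) ≫
        (α_ (P.map (F.map f)) (P.map (α.app b)) (P.map (G.map g))).inv ≫
        ((P.mapComp (F.map f) (α.app b)).inv ≫ P.map₂ (α.naturality f) ≫
          (P.mapComp (α.app a) (G.map f)).hom) ▷ P.map (G.map g) ≫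
        (α_ (P.map (α.app a)) (P.map (G.map f)) (P.map (G.map g))).hom
    have h := congrArg P.map₂ (α.naturality_comp f g)
    have ha : ∀ {x y z w : C} (p : x ⟶ y) (q : y ⟶ z) (r : z ⟶ w), P.map₂ (α_ p q r).inv =
        (P.mapComp p (q ≫ r)).hom ≫ P.map p ◁ (P.mapComp q r).hom ≫
          (α_ (P.map p) (P.map q) (P.map r)).inv ≫ (P.mapComp p q).inv ▷ P.map r ≫
          (P.mapComp (p ≫ q) r).inv := by
      intro x y z w p q r
      rw [P.map₂_iso_inv, IsIso.inv_eq_of_hom_inv_id]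
      rw [P.map₂_associator]
      simp
    simp only [P.map₂_comp, P.map₂_whisker_left, P.map₂_whisker_right, Category.assoc,
      P.map₂_associator, ha] at h
    rw [← cancel_epi (P.mapComp (F.map (f ≫ g)) (α.app c)).hom,
      ← cancel_mono (P.map (α.app a) ◁ (P.mapComp (G.map f) (G.map g)).inv),
      ← cancel_mono (P.mapComp (α.app a) (G.map f ≫ G.map g)).inv]
    simpa using h

/-- For `η : 1 ⇒ GF`, the colax transformation `ηH : H ⇒ GFH`. -/
def unitPre (H : B ⥤ᵒᵖᴸ C) {F : C ⥤ᵒᵖᴸ D} {G : D ⥤ᵒᵖᴸ C}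
    (η : Oplax.OplaxTrans (OplaxFunctor.id C) (F.comp G)) :
    Oplax.OplaxTrans H ((H.comp F).comp G) where
  app a := η.app (H.obj a)
  naturality f := η.naturality (H.map f)
  naturality_naturality ξ := (pre H η).naturality_naturality ξ
  naturality_id a := by
    have e₁ : H.mapId a ≫ 𝟙 _ = H.mapId a := Category.comp_id _
    have e₂ : G.map₂ (F.map₂ (H.mapId a) ≫ F.mapId (H.obj a)) ≫ G.mapId (F.obj (H.obj a)) =
        G.map₂ (F.map₂ (H.mapId a)) ≫ G.map₂ (F.mapId (H.obj a)) ≫ G.mapId (F.obj (H.obj a)) := by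
      rw [G.map₂_comp, Category.assoc]
    exact (congrArg (fun t => η.naturality (H.map (𝟙 a)) ≫ η.app (H.obj a) ◁ t) e₂).trans
      (((pre H η).naturality_id a).trans
        (congrArg (fun t => t ▷ η.app (H.obj a) ≫ (λ_ _).hom ≫ (ρ_ _).inv) e₁))
  naturality_comp {a b c} f g := by
    have e₁ : H.mapComp f g ≫ 𝟙 _ = H.mapComp f g := Category.comp_id _
    have e₂ : G.map₂ (F.map₂ (H.mapComp f g) ≫ F.mapComp (H.map f) (H.map g)) ≫
        G.mapComp (F.map (H.map f)) (F.map (H.map g)) =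
        G.map₂ (F.map₂ (H.mapComp f g)) ≫ G.map₂ (F.mapComp (H.map f) (H.map g)) ≫
        G.mapComp (F.map (H.map f)) (F.map (H.map g)) := by
      rw [G.map₂_comp, Category.assoc]
    exact (congrArg (fun t => η.naturality (H.map (f ≫ g)) ≫ η.app (H.obj a) ◁ t) e₂).trans
      (((pre H η).naturality_comp f g).trans
        (congrArg (fun t => t ▷ η.app (H.obj c) ≫ (α_ _ _ _).hom ≫
          H.map f ◁ η.naturality (H.map g) ≫ (α_ _ _ _).inv ≫
          η.naturality (H.map f) ▷ G.map (F.map (H.map g)) ≫ (α_ _ _ _).hom) e₁))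

/-- For `e : GF ⇒ 1`, the colax transformation `eH : GFH ⇒ H`. -/
def counitPre (H : B ⥤ᵒᵖᴸ C) {F : C ⥤ᵒᵖᴸ D} {G : D ⥤ᵒᵖᴸ C}
    (e : Oplax.OplaxTrans (F.comp G) (OplaxFunctor.id C)) :
    Oplax.OplaxTrans ((H.comp F).comp G) H where
  app a := e.app (H.obj a)
  naturality f := e.naturality (H.map f)
  naturality_naturality ξ := (pre H e).naturality_naturality ξ
  naturality_id a := by
    have e₁ : H.mapId a = H.mapId a ≫ 𝟙 _ := (Category.comp_id _).symm
    have e₂ : G.map₂ (F.map₂ (H.mapId a)) ≫ G.map₂ (F.mapId (H.obj a)) ≫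
        G.mapId (F.obj (H.obj a)) =
        G.map₂ (F.map₂ (H.mapId a) ≫ F.mapId (H.obj a)) ≫ G.mapId (F.obj (H.obj a)) := by
      rw [G.map₂_comp, Category.assoc]
    exact (congrArg (fun t => e.naturality (H.map (𝟙 a)) ≫ e.app (H.obj a) ◁ t) e₁).trans
      (((pre H e).naturality_id a).trans
        (congrArg (fun t => t ▷ e.app (H.obj a) ≫ (λ_ _).hom ≫ (ρ_ _).inv) e₂))
  naturality_comp {a b c} f g := by
    have e₁ : H.mapComp f g = H.mapComp f g ≫ 𝟙 _ := (Category.comp_id _).symm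
    have e₂ : G.map₂ (F.map₂ (H.mapComp f g)) ≫ G.map₂ (F.mapComp (H.map f) (H.map g)) ≫
        G.mapComp (F.map (H.map f)) (F.map (H.map g)) =
        G.map₂ (F.map₂ (H.mapComp f g) ≫ F.mapComp (H.map f) (H.map g)) ≫
        G.mapComp (F.map (H.map f)) (F.map (H.map g)) := by
      rw [G.map₂_comp, Category.assoc]
    exact (congrArg (fun t => e.naturality (H.map (f ≫ g)) ≫ e.app (H.obj a) ◁ t) e₁).trans
      (((pre H e).naturality_comp f g).trans
        (congrArg (fun t => t ▷ e.app (H.obj c) ≫ (α_ _ _ _).hom ≫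
          G.map (F.map (H.map f)) ◁ e.naturality (H.map g) ≫ (α_ _ _ _).inv ≫
          e.naturality (H.map f) ▷ H.map g ≫ (α_ _ _ _).hom) e₂))

/-- For `η : 1 ⇒ GF` and a pseudofunctor `P`, the colax transformation `Pη : P ⇒ PGF`. -/
def unitPost {F : B ⥤ᵒᵖᴸ C} {G : C ⥤ᵒᵖᴸ B}
    (η : Oplax.OplaxTrans (OplaxFunctor.id B) (F.comp G)) (P : B ⥤ᵖ D) :
    Oplax.OplaxTrans P.toOplax ((F.comp G).comp P.toOplax) where
  app a := P.map (η.app a)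
  naturality {a b} f := (P.mapComp f (η.app b)).inv ≫ P.map₂ (η.naturality f) ≫
    (P.mapComp (η.app a) (G.map (F.map f))).hom
  naturality_naturality ξ := (post η P).naturality_naturality ξ
  naturality_id a := by
    have e₁ : P.map₂ (𝟙 (𝟙 a)) ≫ (P.mapId a).hom = (P.mapId a).hom := by
      rw [P.map₂_id, Category.id_comp]
    exact ((post η P).naturality_id a).trans
      (congrArg (fun t => t ▷ P.map (η.app a) ≫ (λ_ _).hom ≫ (ρ_ _).inv) e₁)
  naturality_comp {a b c} f g := by
    have e₁ : P.map₂ (𝟙 (f ≫ g)) ≫ (P.mapComp f g).hom = (P.mapComp f g).hom := by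
      rw [P.map₂_id, Category.id_comp]
    exact ((post η P).naturality_comp f g).trans
      (congrArg (fun t => t ▷ P.map (η.app c) ≫ (α_ _ _ _).hom ≫
        P.map f ◁ (post η P).naturality g ≫ (α_ _ _ _).inv ≫
        (post η P).naturality f ▷ P.map (G.map (F.map g)) ≫ (α_ _ _ _).hom) e₁)

/-- For `e : GF ⇒ 1` and a pseudofunctor `P`, the colax transformation `Pe : PGF ⇒ P`. -/
def counitPost {F : B ⥤ᵒᵖᴸ C} {G : C ⥤ᵒᵖᴸ B}
    (e : Oplax.OplaxTrans (F.comp G) (OplaxFunctor.id B)) (P : B ⥤ᵖ D) :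
    Oplax.OplaxTrans ((F.comp G).comp P.toOplax) P.toOplax where
  app a := P.map (e.app a)
  naturality {a b} f := (P.mapComp (G.map (F.map f)) (e.app b)).inv ≫
    P.map₂ (e.naturality f) ≫ (P.mapComp (e.app a) f).hom
  naturality_naturality ξ := (post e P).naturality_naturality ξ
  naturality_id a := by
    have e₁ : (P.mapId a).hom = P.map₂ (𝟙 (𝟙 a)) ≫ (P.mapId a).hom := by
      rw [P.map₂_id, Category.id_comp]
    exact (congrArg (fun t => (post e P).naturality (𝟙 a) ≫ P.map (e.app a) ◁ t) e₁).trans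
      ((post e P).naturality_id a)
  naturality_comp {a b c} f g := by
    have e₁ : (P.mapComp f g).hom = P.map₂ (𝟙 (f ≫ g)) ≫ (P.mapComp f g).hom := by
      rw [P.map₂_id, Category.id_comp]
    exact (congrArg (fun t => (post e P).naturality (f ≫ g) ≫ P.map (e.app a) ◁ t) e₁).trans
      ((post e P).naturality_comp f g)

end Whiskering

section Adjunctions

variable {C : Type u₁} [Bicategory.{w₁, v₁} C] {D : Type u₂} [Bicategory.{w₂, v₂} D]

/-- Colax transformations `1 ⇒ UF`. -/
abbrev ColaxUnit (F : D ⥤ᵒᵖᴸ C) (U : C ⥤ᵖ D) :=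
  Oplax.OplaxTrans (OplaxFunctor.id D) (F.comp U.toOplax)

/-- Colax transformations `FU ⇒ 1`. -/
abbrev ColaxCounit (F : D ⥤ᵒᵖᴸ C) (U : C ⥤ᵖ D) :=
  Oplax.OplaxTrans (U.toOplax.comp F) (OplaxFunctor.id C)

/-- Modifications `Φ : 1_U ⟶ Ue ∘ ηU`. -/
abbrev RightTriangulator {F : D ⥤ᵒᵖᴸ C} {U : C ⥤ᵖ D} (η : ColaxUnit F U) (e : ColaxCounit F U) :=
  Oplax.OplaxTrans.Modification (Oplax.OplaxTrans.id U.toOplax)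
    (Oplax.OplaxTrans.vcomp (unitPre U.toOplax η) (counitPost e U))

/-- Modifications `Ψ : eF ∘ Fη ⟶ 1_F`, for a pseudofunctor `F`. -/
abbrev LeftTriangulator {F : D ⥤ᵖ C} {U : C ⥤ᵖ D} (η : ColaxUnit F.toOplax U)
    (e : ColaxCounit F.toOplax U) :=
  Oplax.OplaxTrans.Modification
    (Oplax.OplaxTrans.vcomp (unitPost η F) (counitPre F.toOplax e))
    (Oplax.OplaxTrans.id F.toOplax)

/-- `(Ψ, Φ) : (e, η)` is a colax adjunction with left adjoint `F` and right adjoint `U`: the two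
swallowtail identities hold. -/
structure IsColaxAdjunction {F : D ⥤ᵖ C} {U : C ⥤ᵖ D} (η : ColaxUnit F.toOplax U)
    (e : ColaxCounit F.toOplax U) (Ψ : LeftTriangulator η e) (Φ : RightTriangulator η e) :
    Prop where
  /-- The composite
  `η_A ⟶ U e_{FA} ∘ η_{UFA} ∘ η_A ⟶ U e_{FA} ∘ UFη_A ∘ η_A ⟶ η_A` is the identity. -/
  swallowtail_unit (A : D) :
    (ρ_ (η.app A)).inv ≫ η.app A ◁ Φ.app (F.obj A) ≫
      (α_ (η.app A) (η.app (U.obj (F.obj A))) (U.map (e.app (F.obj A)))).inv ≫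
      η.naturality (η.app A) ▷ U.map (e.app (F.obj A)) ≫
      (α_ (η.app A) (U.map (F.map (η.app A))) (U.map (e.app (F.obj A)))).hom ≫
      η.app A ◁ ((U.mapComp (F.map (η.app A)) (e.app (F.obj A))).inv ≫ U.map₂ (Ψ.app A) ≫
        (U.mapId (F.obj A)).hom) ≫
      (ρ_ (η.app A)).hom = 𝟙 (η.app A)
  /-- The composite
  `e_B ⟶ e_B ∘ FU e_B ∘ Fη_{UB} ⟶ e_B ∘ e_{FUB} ∘ Fη_{UB} ⟶ e_B` is the identity. -/
  swallowtail_counit (B : C) :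
    (λ_ (e.app B)).inv ≫
      ((F.mapId (U.obj B)).inv ≫ F.map₂ (Φ.app B) ≫
        (F.mapComp (η.app (U.obj B)) (U.map (e.app B))).hom) ▷ e.app B ≫
      (α_ (F.map (η.app (U.obj B))) (F.map (U.map (e.app B))) (e.app B)).hom ≫
      F.map (η.app (U.obj B)) ◁ e.naturality (e.app B) ≫
      (α_ (F.map (η.app (U.obj B))) (e.app (F.obj (U.obj B))) (e.app B)).inv ≫
      Ψ.app (U.obj B) ▷ e.app B ≫
      (λ_ (e.app B)).hom = 𝟙 (e.app B)

end Adjunctions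

end ColaxAdj

/-! A 2-cell out of a left `U`-extension is the same as its transpose, the paste `mapCell U ψ θ`
with the universal cell. So structure cells can be defined by prescribing transposes, and equations
between them can be checked on transposes, where they become identities of pasting in `D`. `F f` is
the chosen extension of `f ≫ y B`, and its 2-cells, unitor and compositor come from the universal
property; the axioms for `y` are then their defining equations. The counit is the extension of an
identity. Its naturality cell at `f` starts at the composite `F (U f) ≫ ε`, and coherent closure is
what makes this composite an extension of `U f`. The unit and composition axioms make the unitor and
compositor of `F` comparisons between two extensions of one 1-cell, hence invertible
(`isIso_of_fac`). The left triangulator likewise compares two extensions of `y A`. Apart from the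
unit swallowtail, which restates its definition, everything about it rests on
`mapCell_coherentCell_leftTriangle`. -/

namespace ColaxAdj

/-! ### Calculus of pasted cells: transposes and their compatibility with associators and unitors.
-/

section PastingCalculus

variable {C : Type u₁} [Bicategory.{w₁, v₁} C] {D : Type u₂} [Bicategory.{w₂, v₂} D]

/-- A cell `φ : f ⟶ y ≫ U f'` followed by `U g`, with the inverse of the compositor. -/
def postCell (U : C ⥤ᵖ D) {A : D} {X Y Z : C} {y : A ⟶ U.obj X}
    {f : A ⟶ U.obj Y} {f' : X ⟶ Y} (φ : f ⟶ y ≫ U.map f') (g : Y ⟶ Z) :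
    f ≫ U.map g ⟶ y ≫ U.map (f' ≫ g) :=
  φ ▷ U.map g ≫ (α_ y (U.map f') (U.map g)).hom ≫ y ◁ (U.mapComp f' g).inv

/-- A cell `φ : f ⟶ y ≫ U f'` followed by `y ◁ U θ`. -/
def mapCell (U : C ⥤ᵖ D) {A : D} {X Y : C} {y : A ⟶ U.obj X} {f : A ⟶ U.obj Y} {f' g : X ⟶ Y}
    (φ : f ⟶ y ≫ U.map f') (θ : f' ⟶ g) : f ⟶ y ≫ U.map g :=
  φ ≫ y ◁ U.map₂ θ

/-- The cell `y ⟶ y ≫ U 𝟙` given by the unitor of `U`. -/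
def unitCell (U : C ⥤ᵖ D) {A : D} {X : C} (y : A ⟶ U.obj X) : y ⟶ y ≫ U.map (𝟙 X) :=
  (ρ_ y).inv ≫ y ◁ (U.mapId X).inv

variable (U : C ⥤ᵖ D) {A B B' : D} {X Y Z W : C} {y : A ⟶ U.obj X} {z : B ⟶ U.obj Y}

lemma pasteCell_eq {f : A ⟶ B} {g : B ⟶ U.obj Z} {f' : X ⟶ Y} {g' : Y ⟶ Z}
    (φ : f ≫ z ⟶ y ≫ U.map f') (ψ : g ⟶ z ≫ U.map g') :
    pasteCell U φ ψ = f ◁ ψ ≫ (α_ f z (U.map g')).inv ≫ postCell U φ g' := rfl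

lemma postCell_comp {f₁ f : A ⟶ U.obj Y} {f' : X ⟶ Y} (β : f₁ ⟶ f)
    (φ : f ⟶ y ≫ U.map f') (g : Y ⟶ Z) :
    postCell U (β ≫ φ) g = β ▷ U.map g ≫ postCell U φ g := by
  simp [postCell]

lemma comp_mapCell {f g : A ⟶ U.obj Y} {f' g' : X ⟶ Y} (β : f ⟶ g) (φ : g ⟶ y ≫ U.map f')
    (θ : f' ⟶ g') : mapCell U (β ≫ φ) θ = β ≫ mapCell U φ θ :=
  Category.assoc _ _ _

lemma mapCell_comp {f : A ⟶ U.obj Y} {f' g h : X ⟶ Y} (φ : f ⟶ y ≫ U.map f') (θ : f' ⟶ g)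
    (τ : g ⟶ h) : mapCell U φ (θ ≫ τ) = mapCell U (mapCell U φ θ) τ := by
  simp [mapCell]

lemma mapCell_id {f : A ⟶ U.obj Y} {f' : X ⟶ Y} (φ : f ⟶ y ≫ U.map f') :
    mapCell U φ (𝟙 f') = φ := by
  simp [mapCell]

lemma mapCell_inv_eq {f : A ⟶ U.obj Y} {f' g : X ⟶ Y} {φ : f ⟶ y ≫ U.map f'}
    {ψ : f ⟶ y ≫ U.map g} (θ : f' ≅ g) (h : mapCell U φ θ.hom = ψ) : mapCell U ψ θ.inv = φ := by
  rw [← h, ← mapCell_comp, Iso.hom_inv_id, mapCell_id]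

lemma mapCell_postCell_whiskerRight {f : A ⟶ U.obj Y} {f' f'' : X ⟶ Y}
    (φ : f ⟶ y ≫ U.map f') (θ : f' ⟶ f'') (g : Y ⟶ Z) :
    mapCell U (postCell U φ g) (θ ▷ g) = postCell U (mapCell U φ θ) g := by
  simp [mapCell, postCell]

lemma mapCell_postCell_whiskerLeft {f : A ⟶ U.obj Y} {f' : X ⟶ Y}
    (φ : f ⟶ y ≫ U.map f') {g h : Y ⟶ Z} (θ : g ⟶ h) :
    mapCell U (postCell U φ g) (f' ◁ θ) = f ◁ U.map₂ θ ≫ postCell U φ h := by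
  simp [mapCell, postCell, whisker_exchange_assoc]

lemma postCell_postCell {f : A ⟶ U.obj Y} {f' : X ⟶ Y}
    (φ : f ⟶ y ≫ U.map f') (g : Y ⟶ Z) (h : Z ⟶ W) :
    mapCell U (postCell U (postCell U φ g) h) (α_ f' g h).hom =
      (α_ f (U.map g) (U.map h)).hom ≫ f ◁ (U.mapComp g h).inv ≫ postCell U φ (g ≫ h) := by
  simp [mapCell, postCell, U.map₂_associator, whisker_exchange_assoc]

lemma postCell_id {f : A ⟶ U.obj Y} {f' : X ⟶ Y} (φ : f ⟶ y ≫ U.map f') :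
    mapCell U (postCell U φ (𝟙 Y)) (ρ_ f').hom = f ◁ (U.mapId Y).hom ≫ (ρ_ f).hom ≫ φ := by
  -- Brings `φ` to the front of the right-hand side, where it already stands on the left.
  rw [← rightUnitor_naturality, whisker_exchange_assoc]
  simp [mapCell, postCell, U.map₂_right_unitor]

lemma postCell_unitCell (g : X ⟶ Y) :
    mapCell U (postCell U (unitCell U y) g) (λ_ g).hom = 𝟙 _ := by
  simp [mapCell, postCell, unitCell, U.map₂_left_unitor]

lemma mapCell_pasteCell_whiskerRight {f : A ⟶ B} {g : B ⟶ U.obj Z} {f' f'' : X ⟶ Y} {g' : Y ⟶ Z}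
    (φ : f ≫ z ⟶ y ≫ U.map f') (ψ : g ⟶ z ≫ U.map g') (θ : f' ⟶ f'') :
    mapCell U (pasteCell U φ ψ) (θ ▷ g') = pasteCell U (mapCell U φ θ) ψ := by
  simp only [pasteCell_eq, comp_mapCell, mapCell_postCell_whiskerRight]

lemma mapCell_pasteCell_whiskerLeft {f : A ⟶ B} {g : B ⟶ U.obj Z} {f' : X ⟶ Y} {g' g'' : Y ⟶ Z}
    (φ : f ≫ z ⟶ y ≫ U.map f') (ψ : g ⟶ z ≫ U.map g') (θ : g' ⟶ g'') :
    mapCell U (pasteCell U φ ψ) (f' ◁ θ) = pasteCell U φ (mapCell U ψ θ) := by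
  simp only [pasteCell_eq, comp_mapCell, mapCell_postCell_whiskerLeft]
  simp [mapCell]

lemma pasteCell_comp_left {f₁ f : A ⟶ B} {g : B ⟶ U.obj Z} {f' : X ⟶ Y} {g' : Y ⟶ Z}
    (β : f₁ ⟶ f) (φ : f ≫ z ⟶ y ≫ U.map f') (ψ : g ⟶ z ≫ U.map g') :
    pasteCell U (β ▷ z ≫ φ) ψ = β ▷ g ≫ pasteCell U φ ψ := by
  simp [pasteCell, ← whisker_exchange_assoc]

lemma pasteCell_comp_right {f : A ⟶ B} {g₁ g : B ⟶ U.obj Z} {f' : X ⟶ Y} {g' : Y ⟶ Z}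
    (φ : f ≫ z ⟶ y ≫ U.map f') (β : g₁ ⟶ g) (ψ : g ⟶ z ≫ U.map g') :
    pasteCell U φ (β ≫ ψ) = f ◁ β ≫ pasteCell U φ ψ := by
  simp [pasteCell]

lemma postCell_pasteCell {f : A ⟶ B} {g : B ⟶ U.obj Z} {f' : X ⟶ Y} {g' : Y ⟶ Z}
    (φ : f ≫ z ⟶ y ≫ U.map f') (ψ : g ⟶ z ≫ U.map g') (h : Z ⟶ W) :
    mapCell U (postCell U (pasteCell U φ ψ) h) (α_ f' g' h).hom =
      (α_ f g (U.map h)).hom ≫ pasteCell U φ (postCell U ψ h) := by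
  simp only [pasteCell_eq, postCell_comp, comp_mapCell, postCell_postCell]
  simp [postCell]

/-- Associativity of pasting, the source of the associativity axiom of `F`; the next two lemmas are
the unit laws. -/
lemma pasteCell_pasteCell {f : A ⟶ B} {g : B ⟶ B'} {h : B' ⟶ U.obj W} {w : B' ⟶ U.obj Z}
    {f' : X ⟶ Y} {g' : Y ⟶ Z} {h' : Z ⟶ W}
    (φ : f ≫ z ⟶ y ≫ U.map f') (ψ : g ≫ w ⟶ z ≫ U.map g') (χ : h ⟶ w ≫ U.map h') :
    mapCell U (pasteCell U ((α_ f g w).hom ≫ pasteCell U φ ψ) χ) (α_ f' g' h').hom =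
      (α_ f g h).hom ≫ pasteCell U φ (pasteCell U ψ χ) := by
  rw [pasteCell_eq, postCell_comp, comp_mapCell, comp_mapCell, comp_mapCell, postCell_pasteCell,
    pasteCell_eq U ψ χ, pasteCell_comp_right, pasteCell_comp_right]
  simp

lemma unitCell_pasteCell {g : A ⟶ U.obj Z} {g' : X ⟶ Z} (ψ : g ⟶ y ≫ U.map g') :
    mapCell U (pasteCell U ((λ_ y).hom ≫ unitCell U y) ψ) (λ_ g').hom = (λ_ g).hom ≫ ψ := by
  rw [pasteCell_eq, postCell_comp, comp_mapCell, comp_mapCell, comp_mapCell, postCell_unitCell]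
  simp

lemma pasteCell_unitCell {f : A ⟶ B} {f' : X ⟶ Y} (φ : f ≫ z ⟶ y ≫ U.map f') :
    mapCell U (pasteCell U φ (unitCell U z)) (ρ_ f').hom = φ := by
  rw [pasteCell_eq, comp_mapCell, comp_mapCell, postCell_id]
  simp [unitCell]

end PastingCalculus

/-! ### The universal property of left `U`-extensions. -/

section LeftUExtension

variable {C : Type u₁} [Bicategory.{w₁, v₁} C] {D : Type u₂} [Bicategory.{w₂, v₂} D]
  {U : C ⥤ᵖ D} {A : D} {X B : C} {y : A ⟶ U.obj X} {f : A ⟶ U.obj B} {f' : X ⟶ B}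
  {ψ : f ⟶ y ≫ U.map f'}

namespace IsLeftUExtension

/-- The 2-cell out of a left `U`-extension given by its universal property. -/
noncomputable def desc (h : IsLeftUExtension U y f f' ψ) {g : X ⟶ B} (α : f ⟶ y ≫ U.map g) :
    f' ⟶ g :=
  (h g α).choose

lemma fac (h : IsLeftUExtension U y f f' ψ) {g : X ⟶ B} (α : f ⟶ y ≫ U.map g) :
    mapCell U ψ (h.desc α) = α :=
  (h g α).choose_spec.1

lemma hom_ext (h : IsLeftUExtension U y f f' ψ) {g : X ⟶ B} {θ₁ θ₂ : f' ⟶ g}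
    (e : mapCell U ψ θ₁ = mapCell U ψ θ₂) : θ₁ = θ₂ :=
  (h g _).unique e rfl

/-- Uniqueness of extensions up to isomorphism; the inverse is the transpose in the other direction.
-/
lemma isIso_of_fac {f'' : X ⟶ B} {ψ' : f ⟶ y ≫ U.map f''} (h : IsLeftUExtension U y f f' ψ)
    (h' : IsLeftUExtension U y f f'' ψ') {θ : f' ⟶ f''} (e : mapCell U ψ θ = ψ') :
    IsIso θ := by
  refine ⟨h'.desc ψ, h.hom_ext ?_, h'.hom_ext ?_⟩
  · rw [mapCell_comp, e, fac, mapCell_id]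
  · rw [mapCell_comp, fac, e, mapCell_id]

lemma of_iso {f'' : X ⟶ B} {ψ' : f ⟶ y ≫ U.map f''} (h : IsLeftUExtension U y f f' ψ)
    (θ : f'' ⟶ f') [IsIso θ] (e : mapCell U ψ' θ = ψ) : IsLeftUExtension U y f f'' ψ' := by
  intro g α
  refine ⟨θ ≫ h.desc α, ?_, fun τ hτ => ?_⟩
  · change mapCell U ψ' (θ ≫ h.desc α) = α
    rw [mapCell_comp, e, fac]
  · rw [← IsIso.inv_comp_eq]
    apply h.hom_ext
    rw [fac, ← e, ← mapCell_comp, IsIso.hom_inv_id_assoc]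
    exact hτ

lemma precomp_iso {f₁ : A ⟶ U.obj B} (h : IsLeftUExtension U y f f' ψ) (i : f₁ ≅ f) :
    IsLeftUExtension U y f₁ f' (i.hom ≫ ψ) := by
  intro g α
  refine ⟨h.desc (i.inv ≫ α), ?_, fun τ hτ => h.hom_ext ?_⟩
  · change mapCell U (i.hom ≫ ψ) _ = α
    rw [comp_mapCell, fac, Iso.hom_inv_id_assoc]
  · rw [fac, ← hτ, Category.assoc, Iso.inv_hom_id_assoc]
    rfl

end IsLeftUExtension

end LeftUExtension

section GeneralizedBungeGray

variable {C : Type u₁} [Bicategory.{w₁, v₁} C] {D : Type u₂} [Bicategory.{w₂, v₂} D]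

namespace CoherentlyClosed

variable {U : C ⥤ᵖ D} {F₀ : D → C} {y : ∀ A : D, A ⟶ U.obj (F₀ A)} (E : CoherentlyClosed U F₀ y)

/-! ### The colax functor and the unit. -/

/-- The action of the left adjoint on 1-cells. -/
def map {A B : D} (f : A ⟶ B) : F₀ A ⟶ F₀ B := E.ext (f ≫ y B)

/-- The naturality 2-cell of the unit. -/
def unitNat {A B : D} (f : A ⟶ B) : f ≫ y B ⟶ y A ≫ U.map (E.map f) := E.cell (f ≫ y B)

lemma isLeftUExtension_unitNat {A B : D} (f : A ⟶ B) :
    IsLeftUExtension U (y A) (f ≫ y B) (E.map f) (E.unitNat f) :=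
  E.isLeftUExtension _

/-- The action of the left adjoint on 2-cells. -/
noncomputable def map₂ {A B : D} {f g : A ⟶ B} (β : f ⟶ g) : E.map f ⟶ E.map g :=
  (E.isLeftUExtension_unitNat f).desc (β ▷ y B ≫ E.unitNat g)

/-- The unitor of the left adjoint. -/
noncomputable def mapId (A : D) : E.map (𝟙 A) ⟶ 𝟙 (F₀ A) :=
  (E.isLeftUExtension_unitNat (𝟙 A)).desc ((λ_ (y A)).hom ≫ unitCell U (y A))

/-- The compositor of the left adjoint. -/
noncomputable def mapComp {A B Z : D} (f : A ⟶ B) (g : B ⟶ Z) :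
    E.map (f ≫ g) ⟶ E.map f ≫ E.map g :=
  (E.isLeftUExtension_unitNat (f ≫ g)).desc
    ((α_ f g (y Z)).hom ≫ pasteCell U (E.unitNat f) (E.unitNat g))

lemma unitNat_map₂ {A B : D} {f g : A ⟶ B} (β : f ⟶ g) :
    mapCell U (E.unitNat f) (E.map₂ β) = β ▷ y B ≫ E.unitNat g :=
  IsLeftUExtension.fac _ _

lemma unitNat_mapId (A : D) :
    mapCell U (E.unitNat (𝟙 A)) (E.mapId A) = (λ_ (y A)).hom ≫ unitCell U (y A) :=
  IsLeftUExtension.fac _ _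

lemma unitNat_mapComp {A B Z : D} (f : A ⟶ B) (g : B ⟶ Z) :
    mapCell U (E.unitNat (f ≫ g)) (E.mapComp f g) =
      (α_ f g (y Z)).hom ≫ pasteCell U (E.unitNat f) (E.unitNat g) :=
  IsLeftUExtension.fac _ _

lemma map₂_id {A B : D} (f : A ⟶ B) : E.map₂ (𝟙 f) = 𝟙 (E.map f) := by
  apply (E.isLeftUExtension_unitNat f).hom_ext
  simp [unitNat_map₂, mapCell_id]

lemma map₂_comp {A B : D} {f g h : A ⟶ B} (β : f ⟶ g) (γ : g ⟶ h) :
    E.map₂ (β ≫ γ) = E.map₂ β ≫ E.map₂ γ := by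
  apply (E.isLeftUExtension_unitNat f).hom_ext
  simp [mapCell_comp, comp_mapCell, unitNat_map₂]

lemma mapComp_naturality_left {A B Z : D} {f f' : A ⟶ B} (β : f ⟶ f') (g : B ⟶ Z) :
    E.map₂ (β ▷ g) ≫ E.mapComp f' g = E.mapComp f g ≫ E.map₂ β ▷ E.map g := by
  apply (E.isLeftUExtension_unitNat _).hom_ext
  simp [mapCell_comp, comp_mapCell, unitNat_map₂, unitNat_mapComp, mapCell_pasteCell_whiskerRight,
    pasteCell_comp_left]

lemma mapComp_naturality_right {A B Z : D} (f : A ⟶ B) {g g' : B ⟶ Z} (β : g ⟶ g') :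
    E.map₂ (f ◁ β) ≫ E.mapComp f g' = E.mapComp f g ≫ E.map f ◁ E.map₂ β := by
  apply (E.isLeftUExtension_unitNat _).hom_ext
  simp [mapCell_comp, comp_mapCell, unitNat_map₂, unitNat_mapComp, mapCell_pasteCell_whiskerLeft,
    pasteCell_comp_right]

/-- Both sides transpose to the threefold paste of the unit cells of `f`, `g` and `h`, up to
associators in `D`. -/
lemma map₂_associator {A B Z W : D} (f : A ⟶ B) (g : B ⟶ Z) (h : Z ⟶ W) :
    E.map₂ (α_ f g h).hom ≫ E.mapComp f (g ≫ h) ≫ E.map f ◁ E.mapComp g h =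
      E.mapComp (f ≫ g) h ≫ E.mapComp f g ▷ E.map h ≫
        (α_ (E.map f) (E.map g) (E.map h)).hom := by
  apply (E.isLeftUExtension_unitNat _).hom_ext
  simp [mapCell_comp, comp_mapCell, unitNat_map₂, unitNat_mapComp, mapCell_pasteCell_whiskerLeft,
    mapCell_pasteCell_whiskerRight, pasteCell_comp_right, pasteCell_pasteCell]

lemma map₂_leftUnitor {A B : D} (f : A ⟶ B) :
    E.map₂ (λ_ f).hom = E.mapComp (𝟙 A) f ≫ E.mapId A ▷ E.map f ≫ (λ_ (E.map f)).hom := by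
  apply (E.isLeftUExtension_unitNat _).hom_ext
  simp [mapCell_comp, comp_mapCell, unitNat_map₂, unitNat_mapComp, unitNat_mapId,
    mapCell_pasteCell_whiskerRight, unitCell_pasteCell]

lemma map₂_rightUnitor {A B : D} (f : A ⟶ B) :
    E.map₂ (ρ_ f).hom = E.mapComp f (𝟙 B) ≫ E.map f ◁ E.mapId B ≫ (ρ_ (E.map f)).hom := by
  apply (E.isLeftUExtension_unitNat _).hom_ext
  simp [mapCell_comp, comp_mapCell, unitNat_map₂, unitNat_mapComp, unitNat_mapId,
    mapCell_pasteCell_whiskerLeft, pasteCell_comp_right, pasteCell_unitCell]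

/-- The colax functor extending `A ↦ F₀ A`. -/
noncomputable def leftAdjoint : D ⥤ᵒᵖᴸ C where
  obj := F₀
  map := E.map
  map₂ := E.map₂
  map₂_id := E.map₂_id
  map₂_comp := E.map₂_comp
  mapId := E.mapId
  mapComp := E.mapComp
  mapComp_naturality_left := E.mapComp_naturality_left
  mapComp_naturality_right f _ _ β := E.mapComp_naturality_right f β
  map₂_associator := E.map₂_associator
  map₂_leftUnitor := E.map₂_leftUnitor
  map₂_rightUnitor := E.map₂_rightUnitor

/-- The colax transformation extending `y`. -/
noncomputable def unit : ColaxUnit E.leftAdjoint U where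
  app := y
  naturality := E.unitNat
  naturality_naturality β := (E.unitNat_map₂ β).symm
  naturality_id A := by
    change E.unitNat (𝟙 A) ≫ y A ◁ (U.map₂ (E.mapId A) ≫ (U.mapId _).hom) =
      𝟙 (𝟙 A) ▷ y A ≫ (λ_ (y A)).hom ≫ (ρ_ (y A)).inv
    -- The defining equation of `mapId` is this axiom, up to the unitor of `U`.
    have h := E.unitNat_mapId A
    rw [mapCell] at h
    simp [reassoc_of% h, unitCell]
  naturality_comp {A B Z} f g := by
    change E.unitNat (f ≫ g) ≫ y A ◁ (U.map₂ (E.mapComp f g) ≫ (U.mapComp _ _).hom) =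
      𝟙 (f ≫ g) ▷ y Z ≫ (α_ f g (y Z)).hom ≫ f ◁ E.unitNat g ≫ (α_ _ _ _).inv ≫
        E.unitNat f ▷ U.map (E.map g) ≫ (α_ _ _ _).hom
    have h := E.unitNat_mapComp f g
    rw [mapCell] at h
    simp [reassoc_of% h, pasteCell]

/-! ### The counit and the right triangulator. -/

/-- The components of the counit. -/
def counitApp (B : C) : F₀ (U.obj B) ⟶ B := E.ext (𝟙 (U.obj B))

/-- The components of the right triangulator. -/
def triangleCell (B : C) : 𝟙 (U.obj B) ⟶ y (U.obj B) ≫ U.map (E.counitApp B) :=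
  E.cell (𝟙 (U.obj B))

lemma isLeftUExtension_triangleCell (B : C) :
    IsLeftUExtension U (y (U.obj B)) (𝟙 (U.obj B)) (E.counitApp B) (E.triangleCell B) :=
  E.isLeftUExtension _

/-- The 2-cell exhibiting the left `U`-extension of the coherence axiom. -/
def coherentCell {A : D} {B : C} (f : A ⟶ U.obj B) :
    f ⟶ y A ≫ U.map (E.map f ≫ E.counitApp B) :=
  (ρ_ f).inv ≫ pasteCell U (E.unitNat f) (E.triangleCell B)

lemma isLeftUExtension_coherentCell {A : D} {B : C} (f : A ⟶ U.obj B) :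
    IsLeftUExtension U (y A) f (E.map f ≫ E.counitApp B) (E.coherentCell f) :=
  E.coherent f

lemma coherentCell_map₂ {A : D} {B : C} {f g : A ⟶ U.obj B} (β : f ⟶ g) :
    mapCell U (E.coherentCell f) (E.map₂ β ▷ E.counitApp B) = β ≫ E.coherentCell g := by
  simp [coherentCell, comp_mapCell, mapCell_pasteCell_whiskerRight, unitNat_map₂,
    pasteCell_comp_left]

lemma coherentCell_mapId (B : C) :
    mapCell U (E.coherentCell (𝟙 (U.obj B))) (E.mapId (U.obj B) ▷ E.counitApp B) =
      mapCell U (E.triangleCell B) (λ_ (E.counitApp B)).inv := by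
  symm
  apply mapCell_inv_eq
  -- The paste yields a left unitor of `𝟙`, while `coherentCell` starts with an inverse right
  -- unitor; `unitors_equal` lets them cancel.
  simp [coherentCell, comp_mapCell, mapCell_pasteCell_whiskerRight, unitNat_mapId,
    unitCell_pasteCell, unitors_equal]

/-- By associativity of pasting, extending `f ≫ g` amounts to extending `g` and then pasting with
the unit cell of `f`. -/
lemma coherentCell_mapComp {A B : D} {Z : C} (f : A ⟶ B) (g : B ⟶ U.obj Z) :
    mapCell U (mapCell U (E.coherentCell (f ≫ g)) (E.mapComp f g ▷ E.counitApp Z))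
      (α_ (E.map f) (E.map g) (E.counitApp Z)).hom =
    pasteCell U (E.unitNat f) (E.coherentCell g) := by
  simp [coherentCell, comp_mapCell, mapCell_pasteCell_whiskerRight, unitNat_mapComp,
    pasteCell_pasteCell, pasteCell_comp_right]

lemma mapCell_pasteCell_triangleCell {A : D} {B Z : C} (f : A ⟶ U.obj B) (g : B ⟶ Z) :
    mapCell U (pasteCell U (E.unitNat f) (postCell U (E.triangleCell B) g))
      (α_ (E.map f) (E.counitApp B) g).inv =
      f ◁ (λ_ (U.map g)).hom ≫ postCell U (E.coherentCell f) g := by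
  -- The triangle identity produces the right unitor of `f` that cancels the inverse one in
  -- `coherentCell f`.
  have e : f ◁ (λ_ (U.map g)).hom = (α_ f (𝟙 _) (U.map g)).inv ≫ (ρ_ f).hom ▷ U.map g := by simp
  rw [e, Category.assoc, Iso.eq_inv_comp, ← comp_mapCell, ← postCell_comp]
  apply mapCell_inv_eq
  simp [coherentCell, postCell_pasteCell]

/-- The naturality 2-cell of the counit. -/
noncomputable def counitNat {A B : C} (f : A ⟶ B) :
    E.map (U.map f) ≫ E.counitApp B ⟶ E.counitApp A ≫ f :=
  (E.isLeftUExtension_coherentCell (U.map f)).desc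
    ((λ_ (U.map f)).inv ≫ postCell U (E.triangleCell A) f)

lemma coherentCell_counitNat {A B : C} (f : A ⟶ B) :
    mapCell U (E.coherentCell (U.map f)) (E.counitNat f) =
      (λ_ (U.map f)).inv ≫ postCell U (E.triangleCell A) f :=
  IsLeftUExtension.fac _ _

lemma counitNat_naturality {A B : C} {f g : A ⟶ B} (β : f ⟶ g) :
    E.map₂ (U.map₂ β) ▷ E.counitApp B ≫ E.counitNat g = E.counitNat f ≫ E.counitApp A ◁ β := by
  apply (E.isLeftUExtension_coherentCell _).hom_ext
  simp [mapCell_comp, comp_mapCell, coherentCell_map₂, coherentCell_counitNat,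
    mapCell_postCell_whiskerLeft]

lemma counitNat_id (A : C) :
    E.counitNat (𝟙 A) = (E.map₂ (U.mapId A).hom ≫ E.mapId (U.obj A)) ▷ E.counitApp A ≫
      (λ_ (E.counitApp A)).hom ≫ (ρ_ (E.counitApp A)).inv := by
  rw [← Category.assoc, Iso.eq_comp_inv]
  apply (E.isLeftUExtension_coherentCell _).hom_ext
  simp [mapCell_comp, comp_mapCell, coherentCell_map₂, coherentCell_counitNat,
    coherentCell_mapId, postCell_id]
  simp [← mapCell_comp, mapCell_id]

/-- On transposes, `counitNat g` replaces the inner coherent cell by a triangle cell, which is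
absorbed into the coherent cell of `U f`; `counitNat f` then leaves the triangle cell at `A`
followed by `U f` and `U g`. -/
lemma counitNat_comp {A B Z : C} (f : A ⟶ B) (g : B ⟶ Z) :
    E.counitNat (f ≫ g) =
      (E.map₂ (U.mapComp f g).hom ≫ E.mapComp (U.map f) (U.map g)) ▷ E.counitApp Z ≫
        (α_ _ _ _).hom ≫ E.map (U.map f) ◁ E.counitNat g ≫ (α_ _ _ _).inv ≫
          E.counitNat f ▷ g ≫ (α_ _ _ _).hom := by
  apply (E.isLeftUExtension_coherentCell _).hom_ext
  simp [mapCell_comp, comp_mapCell, coherentCell_map₂, coherentCell_counitNat,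
    coherentCell_mapComp, mapCell_pasteCell_whiskerLeft, pasteCell_comp_right,
    mapCell_pasteCell_triangleCell, mapCell_postCell_whiskerRight, postCell_comp,
    postCell_postCell]

/-- The colax counit. -/
noncomputable def counit : ColaxCounit E.leftAdjoint U where
  app := E.counitApp
  naturality := E.counitNat
  naturality_naturality β := E.counitNat_naturality β
  naturality_id A := by
    refine (?_ : E.counitNat (𝟙 A) ≫ E.counitApp A ◁ 𝟙 (𝟙 A) = _).trans (E.counitNat_id A)
    simp
  naturality_comp {A B Z} f g := by
    refine (?_ : E.counitNat (f ≫ g) ≫ E.counitApp A ◁ 𝟙 (f ≫ g) = _).trans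
      (E.counitNat_comp f g)
    simp

/-- The modification whose components are the chosen extensions of identities. -/
noncomputable def rightTriangulator : RightTriangulator E.unit E.counit where
  app := E.triangleCell
  naturality {A B} f := by
    change U.map f ◁ E.triangleCell B ≫ (α_ _ _ _).inv ≫
        E.unitNat (U.map f) ▷ U.map (E.counitApp B) ≫ (α_ _ _ _).hom ≫
        y (U.obj A) ◁ ((U.mapComp _ _).inv ≫ U.map₂ (E.counitNat f) ≫ (U.mapComp _ _).hom) ≫
        (α_ _ _ _).inv =
      ((ρ_ (U.map f)).hom ≫ (λ_ (U.map f)).inv) ≫ E.triangleCell A ▷ U.map f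
    -- The modification axiom is the defining equation of `counitNat` with the pasting written out.
    have h := E.coherentCell_counitNat f
    rw [mapCell, coherentCell, pasteCell, postCell, Category.assoc, Iso.inv_comp_eq] at h
    simp only [Category.assoc] at h
    simp only [whiskerLeft_comp, Category.assoc, reassoc_of% h]
    simp

/-! ### Invertibility, the left triangulator and the swallowtail identities. -/

lemma isIso_mapId (hu : UnitAxiom U F₀ y) (A : D) : IsIso (E.mapId A) :=
  (E.isLeftUExtension_unitNat (𝟙 A)).isIso_of_fac ((hu A).precomp_iso (λ_ (y A)))
    (E.unitNat_mapId A)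

lemma isIso_mapComp (hc : CompositionAxiom E) {A B Z : D} (f : A ⟶ B) (g : B ⟶ Z) :
    IsIso (E.mapComp f g) :=
  (E.isLeftUExtension_unitNat (f ≫ g)).isIso_of_fac ((hc f g).precomp_iso (α_ f g (y Z)))
    (E.unitNat_mapComp f g)

/-- The components of the left triangulator. -/
noncomputable def leftTriangle (A : D) : E.map (y A) ≫ E.counitApp (F₀ A) ⟶ 𝟙 (F₀ A) :=
  (E.isLeftUExtension_coherentCell (y A)).desc (unitCell U (y A))

lemma coherentCell_leftTriangle (A : D) :
    mapCell U (E.coherentCell (y A)) (E.leftTriangle A) = unitCell U (y A) :=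
  IsLeftUExtension.fac _ _

lemma isIso_leftTriangle (hu : UnitAxiom U F₀ y) (A : D) : IsIso (E.leftTriangle A) :=
  (E.isLeftUExtension_coherentCell (y A)).isIso_of_fac (hu A) (E.coherentCell_leftTriangle A)

/-- The composite `F (U g ∘ y_A) ⟶ F (U g) ∘ F y_A`, followed by the counit and the left
triangulator, is the transpose of the identity. -/
lemma mapCell_coherentCell_leftTriangle {A : D} {B : C} (g : F₀ A ⟶ B) :
    mapCell U (E.coherentCell (y A ≫ U.map g))
      (E.mapComp (y A) (U.map g) ▷ E.counitApp B ≫ (α_ _ _ _).hom ≫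
        E.map (y A) ◁ E.counitNat g ≫ (α_ _ _ _).inv ≫ E.leftTriangle A ▷ g ≫ (λ_ g).hom) =
      𝟙 (y A ≫ U.map g) := by
  simp [mapCell_comp, comp_mapCell, coherentCell_mapComp, mapCell_pasteCell_whiskerLeft,
    coherentCell_counitNat, pasteCell_comp_right, mapCell_pasteCell_triangleCell,
    mapCell_postCell_whiskerRight, coherentCell_leftTriangle, postCell_unitCell]

/-- The defining equation of `leftTriangle` says that its transpose is the unitor cell of `y A`;
cancelling that unitor gives the identity. -/
lemma unit_swallowtail (A : D) :
    (ρ_ (y A)).inv ≫ y A ◁ E.triangleCell (F₀ A) ≫ (α_ _ _ _).inv ≫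
      E.unitNat (y A) ▷ U.map (E.counitApp (F₀ A)) ≫ (α_ _ _ _).hom ≫
      y A ◁ ((U.mapComp (E.map (y A)) (E.counitApp (F₀ A))).inv ≫ U.map₂ (E.leftTriangle A) ≫
        (U.mapId (F₀ A)).hom) ≫ (ρ_ (y A)).hom = 𝟙 (y A) := by
  have h := E.coherentCell_leftTriangle A
  rw [mapCell, coherentCell, pasteCell, unitCell, Category.assoc] at h
  simp only [Category.assoc] at h
  rw [cancel_epi] at h
  simp only [whiskerLeft_comp, Category.assoc, reassoc_of% h]
  simp

/-- Transposed along `triangleCell B`, the inverse unitor of `F` produces the coherent cell of `𝟙`.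
Naturality of coherent cells then pulls `triangleCell B` out in front, and the remaining factor is
the identity by `mapCell_coherentCell_leftTriangle`. -/
lemma counit_swallowtail (B : C) [IsIso (E.mapId (U.obj B))] :
    (λ_ (E.counitApp B)).inv ≫
      (inv (E.mapId (U.obj B)) ≫ E.map₂ (E.triangleCell B) ≫
        E.mapComp (y (U.obj B)) (U.map (E.counitApp B))) ▷ E.counitApp B ≫
      (α_ _ _ _).hom ≫ E.map (y (U.obj B)) ◁ E.counitNat (E.counitApp B) ≫ (α_ _ _ _).inv ≫
      E.leftTriangle (U.obj B) ▷ E.counitApp B ≫ (λ_ (E.counitApp B)).hom =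
        𝟙 (E.counitApp B) := by
  apply (E.isLeftUExtension_triangleCell B).hom_ext
  have h : mapCell U (mapCell U (E.triangleCell B) (λ_ (E.counitApp B)).inv)
      (inv (E.mapId (U.obj B)) ▷ E.counitApp B) = E.coherentCell (𝟙 (U.obj B)) := by
    rw [← coherentCell_mapId, ← mapCell_comp, ← comp_whiskerRight, IsIso.hom_inv_id,
      id_whiskerRight, mapCell_id]
  rw [comp_whiskerRight, comp_whiskerRight, Category.assoc, Category.assoc, mapCell_comp,
    mapCell_comp, h, mapCell_comp, coherentCell_map₂, comp_mapCell,
    mapCell_coherentCell_leftTriangle, mapCell_id, Category.comp_id]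

/-- The source is a triple composite, isomorphic through the invertible compositor to the coherent
extension of `f ≫ y B`, hence itself an extension. Once the final unitor is moved across, both sides
transpose to `unitNat f`. -/
lemma leftTriangle_naturality {A B : D} (f : A ⟶ B) [IsIso (E.mapComp f (y B))] :
    E.map f ◁ E.leftTriangle B ≫ (ρ_ (E.map f)).hom ≫ (λ_ (E.map f)).inv =
      ((α_ _ _ _).inv ≫ (inv (E.mapComp f (y B)) ≫ E.map₂ (E.unitNat f) ≫
        E.mapComp (y A) (U.map (E.map f))) ▷ E.counitApp (F₀ B) ≫ (α_ _ _ _).hom ≫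
        E.map (y A) ◁ E.counitNat (E.map f) ≫ (α_ _ _ _).inv) ≫ E.leftTriangle A ▷ E.map f := by
  have h : mapCell U (pasteCell U (E.unitNat f) (E.coherentCell (y B)))
      ((α_ (E.map f) (E.map (y B)) (E.counitApp (F₀ B))).inv ≫
        inv (E.mapComp f (y B)) ▷ E.counitApp (F₀ B)) = E.coherentCell (f ≫ y B) := by
    rw [← coherentCell_mapComp, ← mapCell_comp, ← mapCell_comp]
    simp [mapCell_id, ← comp_whiskerRight]
  rw [← Category.assoc, Iso.comp_inv_eq]
  apply ((E.isLeftUExtension_coherentCell (f ≫ y B)).of_iso _ h).hom_ext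
  rw [comp_whiskerRight, comp_whiskerRight]
  simp only [Category.assoc]
  rw [← Category.assoc (α_ _ _ _).inv, mapCell_comp, mapCell_comp, h, mapCell_comp,
    coherentCell_map₂, comp_mapCell, mapCell_coherentCell_leftTriangle,
    mapCell_pasteCell_whiskerLeft, coherentCell_leftTriangle, pasteCell_unitCell, Category.comp_id]

/-- The left triangulator, for a pseudofunctor `F`. -/
noncomputable def leftTriangulator [∀ A : D, IsIso (E.leftAdjoint.mapId A)]
    [∀ {A B Z : D} (f : A ⟶ B) (g : B ⟶ Z), IsIso (E.leftAdjoint.mapComp f g)] :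
    LeftTriangulator (F := Pseudofunctor.mkOfOplax' E.leftAdjoint) E.unit E.counit where
  app := E.leftTriangle
  naturality {_ B} f :=
    haveI : IsIso (E.mapComp f (y B)) := inferInstanceAs (IsIso (E.leftAdjoint.mapComp f (y B)))
    E.leftTriangle_naturality f

lemma isColaxAdjunction [∀ A : D, IsIso (E.leftAdjoint.mapId A)]
    [∀ {A B Z : D} (f : A ⟶ B) (g : B ⟶ Z), IsIso (E.leftAdjoint.mapComp f g)] :
    IsColaxAdjunction (F := Pseudofunctor.mkOfOplax' E.leftAdjoint) E.unit E.counit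
      E.leftTriangulator E.rightTriangulator where
  swallowtail_unit := E.unit_swallowtail
  swallowtail_counit B :=
    haveI : IsIso (E.mapId (U.obj B)) := inferInstanceAs (IsIso (E.leftAdjoint.mapId (U.obj B)))
    E.counit_swallowtail B

end CoherentlyClosed

end GeneralizedBungeGray

end ColaxAdj

theorem theorem3 {C : Type u₁} [Bicategory.{w₁, v₁} C] {D : Type u₂} [Bicategory.{w₂, v₂} D]
    (U : C ⥤ᵖ D) (F₀ : D → C) (y : ∀ A : D, A ⟶ U.obj (F₀ A))
    (E : ColaxAdj.CoherentlyClosed U F₀ y) :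
    ∃ (F : D ⥤ᵒᵖᴸ C) (η : ColaxAdj.ColaxUnit F U) (e : ColaxAdj.ColaxCounit F U)
      (Φ : ColaxAdj.RightTriangulator η e),
      (∀ A, F.obj A = F₀ A) ∧ (∀ A, HEq (η.app A) (y A)) ∧
      (ColaxAdj.UnitAxiom U F₀ y → ColaxAdj.CompositionAxiom E →
        ∃ (_ : ∀ A : D, IsIso (F.mapId A))
          (_ : ∀ {A B Z : D} (f : A ⟶ B) (g : B ⟶ Z), IsIso (F.mapComp f g))
          (Ψ : ColaxAdj.LeftTriangulator (F := Pseudofunctor.mkOfOplax' F) η e),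
          (∀ A : D, IsIso (Ψ.app A)) ∧
            ColaxAdj.IsColaxAdjunction (F := Pseudofunctor.mkOfOplax' F) η e Ψ Φ) := by
  refine ⟨E.leftAdjoint, E.unit, E.counit, E.rightTriangulator, fun _ => rfl, fun _ => HEq.rfl,
    fun hu hc => ?_⟩
  -- Both facts are put in context as instances, through which `Pseudofunctor.mkOfOplax'` turns `F`
  -- into a pseudofunctor.
  have hI : ∀ A : D, IsIso (E.leftAdjoint.mapId A) := E.isIso_mapId hu
  have hC : ∀ {A B Z : D} (f : A ⟶ B) (g : B ⟶ Z), IsIso (E.leftAdjoint.mapComp f g) :=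
    E.isIso_mapComp hc
  exact ⟨hI, hC, E.leftTriangulator, E.isIso_leftTriangle hu, E.isColaxAdjunction⟩
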